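/- A smooth curve is in $d$-bicycle correspondence ($d>0$) with another one, both parametrized by $t\in\mathbb R$ with values in $\mathbb C=\mathbb R^2$, if for every $t$ the segment joining their points at time $t$ has length $d$ and the velocity of the midpoint of this segment is parallel to the segment (possibly zero). Let $\Gamma$ be a smooth closed plane curve of length $L$, parametrized by arc length as an $L$-periodic map $\mathbb R\to\mathbb C$. A number $\rho\in(0,1)$ is a rotation number of $\Gamma$ if $\|\Gamma(t+\rho L)-\Gamma(t)\|$ is a positive constant and, for every $t$, the velocity of the midpoint of the chord from $\Gamma(t)$ to $\Gamma(t+\rho L)$ is parallel to this chord; $\Gamma$ is a Zindler curve if it has at least one rotation number. **Theorem.** Let $k,n$ be relatively prime integers with $1\le k<n$, and let $\ell_{k,n}=1/\sqrt{1-(k/n)^2}$. There is a unique smooth plane curve $\Gamma_{k,n}:\mathbb R\to\mathbb C$ that is $2\pi n$-periodic, is in $2\ell_{k,n}$-bicycle correspondence with the $n$-fold unit circle $t\mapsto e^{it}$, and satisfies $\Gamma_{k,n}(0)=1+2\ell_{k,n}$. It is parametrized by arc length and is closed of length $2\pi n$. It is a Zindler curve if and only if $1\le k\le n-2$. It has exactly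 $n-k-1$ rotation numbers (so none if $k=n-1$), and these are precisely the solutions $\rho\in(0,1)$ of $$n\tan(k\pi\rho)=k\tan(n\pi\rho),$$ where $\rho$ counts as a solution if both tangents are finite and the equation holds, or if $\rho=1/2$ and $k,n$ are both odd (in which case both tangents are infinite). -/

import Mathlib

open scoped ContDiff

/-- Two smooth curves are in `d`-bicycle correspondence (`d > 0`): at every time the segment joining
corresponding points has length `d`, and the velocity of its midpoint is parallel to the segment
(the velocity may vanish, i.e. the common back track may have cusps). -/
structure InBicycleCorrespondence {E : Type*} [NormedAddCommGroup E] [InnerProductSpace ℝ E]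
    (d : ℝ) (Γ₁ Γ₂ : ℝ → E) : Prop where
  pos : 0 < d
  smooth_left : ContDiff ℝ ∞ Γ₁
  smooth_right : ContDiff ℝ ∞ Γ₂
  chord_length : ∀ t, ‖Γ₂ t - Γ₁ t‖ = d
  midpoint_tangent : ∀ t, ∃ c : ℝ,
    deriv (fun s => midpoint ℝ (Γ₁ s) (Γ₂ s)) t = c • (Γ₂ t - Γ₁ t)

/-- A smooth closed curve of length `L`, parametrized by arc length over the whole line as an
`L`-periodic map. Multiply traversed curves are allowed (the `n`-fold circle has length `2πn`). -/
structure IsClosedArcLengthCurve (L : ℝ) (Γ : ℝ → ℂ) : Prop where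
  pos : 0 < L
  smooth : ContDiff ℝ ∞ Γ
  unit_speed : ∀ t, ‖deriv Γ t‖ = 1
  periodic : Function.Periodic Γ L

/-- `ρ ∈ (0,1)` is a rotation number of the closed arc length parametrized curve `Γ` of length `L`:
the chord from `Γ t` to `Γ (t + ρ L)` has constant positive length and the velocity of its midpoint
is parallel to it, i.e. `Γ` and its shift by `ρ L` are in bicycle correspondence. -/
def IsRotationNumber (L : ℝ) (Γ : ℝ → ℂ) (ρ : ℝ) : Prop :=
  ρ ∈ Set.Ioo (0 : ℝ) 1 ∧ ∃ d : ℝ, InBicycleCorrespondence d Γ (fun t => Γ (t + ρ * L))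

/-- A closed arc length parametrized plane curve is a Zindler curve if it has a rotation number. -/
def IsZindlerCurve (L : ℝ) (Γ : ℝ → ℂ) : Prop :=
  IsClosedArcLengthCurve L Γ ∧ ∃ ρ : ℝ, IsRotationNumber L Γ ρ

/-- The bicycle length `ℓ_{k,n} = 1 / √(1 - (k/n)²)`. -/
noncomputable def bicycleLength (k n : ℕ) : ℝ :=
  1 / Real.sqrt (1 - ((k : ℝ) / (n : ℝ)) ^ 2)

/-- The unit circle `t ↦ e^{it}`; over a period `2πn` it is the `n`-fold circle. -/
noncomputable def circleCurve (t : ℝ) : ℂ := Complex.exp ((t : ℂ) * Complex.I)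

/-- The property defining `Γ_{k,n}`: a plane curve closing up after time `2πn`, in
`2ℓ_{k,n}`-bicycle correspondence with the `n`-fold unit circle, starting at `1 + 2ℓ_{k,n}`. -/
structure IsGammaCurve (k n : ℕ) (Γ : ℝ → ℂ) : Prop where
  closed : Function.Periodic Γ (2 * Real.pi * n)
  correspondence : InBicycleCorrespondence (2 * bicycleLength k n) circleCurve Γ
  initial : Γ 0 = ((1 + 2 * bicycleLength k n : ℝ) : ℂ)

/-- `ρ` solves `n tan(kπρ) = k tan(nπρ)`: both tangents are finite and satisfy the equation, or
`ρ = 1/2` and `k`, `n` are both odd (both tangents are infinite; counted as a solution). -/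
def SolvesTanEquation (k n : ℕ) (ρ : ℝ) : Prop :=
  (Real.cos (k * Real.pi * ρ) ≠ 0 ∧ Real.cos (n * Real.pi * ρ) ≠ 0 ∧
    (n : ℝ) * Real.tan (k * Real.pi * ρ) = (k : ℝ) * Real.tan (n * Real.pi * ρ)) ∨
  (ρ = 1 / 2 ∧ Odd k ∧ Odd n)

open Complex ComplexConjugate

/-! Write the second curve as `e^{it}(1 + κ w)` with `|w| = 1` and `κ = (1 + q²)/q` the length of
the segment. Bicycle correspondence becomes the Riccati equation `κ w' = -i(1 + κ w + w²)`, whose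
right side factors through `(w + q)(1 + q w)`. Hence `(w + q)/(1 + q w)` simply rotates, with
angular speed `-r`, `r = (1 - q²)/(1 + q²)`. This gives the explicit solution and its uniqueness
(`eq_gammaCurve`). Its velocity is `-i e^{it} w²`, so the speed is 1; choosing `q² = (n - k)/(n +
k)` gives `r = k/n`, hence period `2πn`.

If the curve corresponds to its shift by `s`, the squared chord is a constant times the product of
the two tangents (`chord_sq`), so the chord is a constant times `e^{it} w(t) w(t + s)`. The explicit
chord (`chord_gammaCurve`) is such a multiple plus an error term, and comparison at two times forces
the error to vanish. The resulting condition, `sin((1 - r)s/2) = q² sin((1 + r)s/2)`, is also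
sufficient, and for `s = 2πnρ` it is the tangent equation.

To count solutions, the difference of the two sides, cleared of denominators, is written as a
positive factor times the sine of a strictly increasing angle (`liftedAngle`) running from `0` to
`(n - k)π` as `ρ` runs from 0 to 1. It crosses `jπ` exactly once for each `0 < j < n - k`. -/

/-! ### The unit circle and nonvanishing denominators. -/

lemma circleCurve_add (s t : ℝ) : circleCurve (s + t) = circleCurve s * circleCurve t := by
  simp only [circleCurve, ← Complex.exp_add]; congr 1; push_cast; ring

lemma circleCurve_zero : circleCurve 0 = 1 := by simp [circleCurve]

lemma norm_circleCurve (t : ℝ) : ‖circleCurve t‖ = 1 := Complex.norm_exp_ofReal_mul_I t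

lemma circleCurve_ne_zero (t : ℝ) : circleCurve t ≠ 0 := Complex.exp_ne_zero _

lemma midpoint_eq_inv_two_mul (z w : ℂ) : midpoint ℝ z w = (2 : ℂ)⁻¹ * (z + w) := by
  simp [midpoint_eq_smul_add, Complex.real_smul, mul_add]

lemma mul_conj_of_norm_eq_one {z : ℂ} (hz : ‖z‖ = 1) : z * conj z = 1 := by
  rw [Complex.mul_conj, Complex.normSq_eq_norm_sq, hz]; simp

lemma circleCurve_mul_conj (t : ℝ) : circleCurve t * conj (circleCurve t) = 1 :=
  mul_conj_of_norm_eq_one (norm_circleCurve t)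

lemma hasDerivAt_circleCurve (t : ℝ) : HasDerivAt circleCurve (I * circleCurve t) t := by
  have h : HasDerivAt (fun t : ℝ => (t : ℂ) * I) (1 * I) t :=
    (Complex.ofRealCLM.hasDerivAt (x := t)).mul_const I
  exact HasDerivAt.congr_deriv (f := circleCurve) h.cexp (by simp [circleCurve, mul_comm])

lemma contDiff_circleCurve : ContDiff ℝ ∞ circleCurve := by
  unfold circleCurve
  exact ((Complex.ofRealCLM.contDiff).mul contDiff_const).cexp

lemma circleCurve_two_pi_mul (m : ℤ) : circleCurve (2 * Real.pi * m) = 1 := by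
  rw [circleCurve, Complex.exp_eq_one_iff]
  exact ⟨m, by push_cast; ring⟩

lemma circleCurve_pi : circleCurve Real.pi = -1 := Complex.exp_pi_mul_I

lemma one_sub_real_mul_ne_zero {q : ℝ} (h0 : 0 < q) (h1 : q < 1) {E : ℂ} (hE : ‖E‖ = 1) :
    1 - q * E ≠ 0 := by
  intro h
  have : ‖(q : ℂ) * E‖ = ‖(1 : ℂ)‖ := by rw [sub_eq_zero.mp h]
  rw [norm_mul, hE, Complex.norm_real, Real.norm_of_nonneg h0.le] at this
  simp at this
  linarith

lemma one_add_real_mul_ne_zero {q : ℝ} (h0 : 0 < q) (h1 : q < 1) {E : ℂ} (hE : ‖E‖ = 1) :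
    1 + q * E ≠ 0 := by
  have := one_sub_real_mul_ne_zero h0 h1 (E := -E) (by simpa using hE)
  simpa using this

lemma add_real_ne_zero {q : ℝ} (h0 : 0 < q) (h1 : q < 1) {E : ℂ} (hE : ‖E‖ = 1) :
    E + q ≠ 0 := by
  intro h
  have : ‖-(q : ℂ)‖ = ‖E‖ := by rw [eq_neg_of_add_eq_zero_left h]
  rw [hE, norm_neg, Complex.norm_real, Real.norm_of_nonneg h0.le] at this
  linarith

lemma one_add_sq_ne_zero (q : ℝ) : (1 + (q : ℂ) ^ 2) ≠ 0 := by
  have : (1 + q ^ 2 : ℝ) ≠ 0 := by positivity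
  exact_mod_cast this

/-! ### The explicit solution of the bicycle equation. -/

/-- The angular speed of the direction of the segment after the Möbius change of variable. -/
noncomputable def angularSpeed (q : ℝ) : ℝ := (1 - q ^ 2) / (1 + q ^ 2)

/-- The Möbius map of the unit disc sending `q` to `0` and fixing `1`. -/
noncomputable def discMap (q : ℝ) (E : ℂ) : ℂ := (E - q) / (1 - q * E)

/-- The direction of the segment relative to the radius of the circle. -/
noncomputable def relDir (q t : ℝ) : ℂ := discMap q (circleCurve (-(angularSpeed q * t)))

/-- The curve in correspondence with the circle with segments of length `(1 + q ^ 2) / q`. -/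
noncomputable def gammaCurve (q t : ℝ) : ℂ := circleCurve t * (1 + (1 + q ^ 2) / q * relDir q t)


/-- On the unit circle the numerator is `E` times the conjugate of the denominator. -/
lemma norm_discMap {q : ℝ} (h0 : 0 < q) (h1 : q < 1) {E : ℂ} (hE : ‖E‖ = 1) : ‖discMap q E‖ = 1 := by
  have h := one_sub_real_mul_ne_zero h0 h1 hE
  have key : E - q = E * conj (1 - q * E) := by
    have := mul_conj_of_norm_eq_one hE
    simp only [map_sub, map_one, map_mul, Complex.conj_ofReal]
    linear_combination (q : ℂ) * this
  rw [discMap, norm_div, key, norm_mul, hE, RCLike.norm_conj, one_mul, div_self (norm_ne_zero_iff.mpr h)]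

lemma norm_relDir {q : ℝ} (h0 : 0 < q) (h1 : q < 1) (t : ℝ) : ‖relDir q t‖ = 1 := norm_discMap h0 h1 (norm_circleCurve _)

lemma relDir_ne_zero {q : ℝ} (h0 : 0 < q) (h1 : q < 1) (t : ℝ) : relDir q t ≠ 0 := by
  rw [← norm_ne_zero_iff, norm_relDir h0 h1]; simp

/-- This is the Riccati equation of the correspondence, with fixed points `-q` and `-1/q`. -/
lemma hasDerivAt_relDir {q : ℝ} (h0 : 0 < q) (h1 : q < 1) (t : ℝ) : HasDerivAt (relDir q)
    (-I * (relDir q t + q) * (1 + q * relDir q t) / (1 + q ^ 2)) t := by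
  have hlin : HasDerivAt (fun t : ℝ => -(angularSpeed q * t)) (-(angularSpeed q * 1)) t :=
    ((hasDerivAt_id t).const_mul _).neg
  have hE := (hasDerivAt_circleCurve (-(angularSpeed q * t))).scomp t hlin
  have hd := one_sub_real_mul_ne_zero h0 h1 (norm_circleCurve (-(angularSpeed q * t)))
  have := (hE.sub_const (q : ℂ)).div ((hE.const_mul (q : ℂ)).const_sub 1) hd
  refine HasDerivAt.congr_deriv (f := relDir q) this ?_
  simp only [relDir, discMap, Function.comp, angularSpeed, Complex.real_smul] at hd ⊢
  set E := circleCurve (-((1 - q ^ 2) / (1 + q ^ 2) * t))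
  have h2 := one_add_sq_ne_zero q
  push_cast
  field_simp
  ring

lemma contDiff_relDir {q : ℝ} (h0 : 0 < q) (h1 : q < 1) : ContDiff ℝ ∞ (relDir q) := by
  have hE : ContDiff ℝ ∞ (fun t : ℝ => circleCurve (-(angularSpeed q * t))) :=
    contDiff_circleCurve.comp (by fun_prop)
  unfold relDir discMap
  simp only [div_eq_mul_inv]
  exact (hE.sub contDiff_const).mul ((contDiff_const.sub (contDiff_const.mul hE)).inv
    fun t => one_sub_real_mul_ne_zero h0 h1 (norm_circleCurve _))

lemma contDiff_gammaCurve {q : ℝ} (h0 : 0 < q) (h1 : q < 1) : ContDiff ℝ ∞ (gammaCurve q) := by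
  unfold gammaCurve
  exact contDiff_circleCurve.mul (contDiff_const.add (contDiff_const.mul (contDiff_relDir h0 h1)))

/-- The Riccati equation cancels all terms but the quadratic one. The result is the circle's tangent
`i e^{it}` reflected in the direction `e^{it} w` of the segment. -/
lemma hasDerivAt_gammaCurve {q : ℝ} (h0 : 0 < q) (h1 : q < 1) (t : ℝ) : HasDerivAt (gammaCurve q)
    (-I * circleCurve t * relDir q t ^ 2) t := by
  have := (hasDerivAt_circleCurve t).mul
    (((hasDerivAt_relDir h0 h1 t).const_mul ((1 + (q : ℂ) ^ 2) / q)).const_add 1)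
  refine HasDerivAt.congr_deriv (f := gammaCurve q) this ?_
  have h2 := one_add_sq_ne_zero q
  have h3 : (q : ℂ) ≠ 0 := by exact_mod_cast h0.ne'
  field_simp
  ring

lemma norm_deriv_gammaCurve {q : ℝ} (h0 : 0 < q) (h1 : q < 1) (t : ℝ) : ‖deriv (gammaCurve q) t‖ = 1 := by
  rw [(hasDerivAt_gammaCurve h0 h1 t).deriv]
  simp [norm_circleCurve, norm_relDir h0 h1]

lemma relDir_zero {q : ℝ} (h1 : q < 1) : relDir q 0 = 1 := by
  have : (1 - q : ℂ) ≠ 0 := by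
    have : (1 - q : ℝ) ≠ 0 := by linarith
    exact_mod_cast this
  simp [relDir, discMap, circleCurve_zero, div_self this]

lemma gammaCurve_sub_circleCurve (q t : ℝ) :
    gammaCurve q t - circleCurve t = (1 + q ^ 2) / q * (circleCurve t * relDir q t) := by
  rw [gammaCurve]; ring

lemma inBicycleCorrespondence_gammaCurve {q : ℝ} (h0 : 0 < q) (h1 : q < 1) :
    InBicycleCorrespondence ((1 + q ^ 2) / q) circleCurve (gammaCurve q) where
  pos := by positivity
  smooth_left := contDiff_circleCurve
  smooth_right := contDiff_gammaCurve h0 h1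
  chord_length t := by
    rw [gammaCurve_sub_circleCurve, norm_mul, norm_mul, norm_circleCurve, norm_relDir h0 h1]
    have : ((1 + (q : ℂ) ^ 2) / q) = (((1 + q ^ 2) / q : ℝ) : ℂ) := by push_cast; rfl
    rw [this, Complex.norm_real, Real.norm_of_nonneg (by positivity)]; ring
  midpoint_tangent t := by
    -- The midpoint velocity is `(i/2) e^{it}(1 - w²) = (Im w) e^{it} w`, and the segment is `κ
    -- e^{it} w`.
    refine ⟨q / (1 + q ^ 2) * (relDir q t).im, ?_⟩
    have hd : HasDerivAt (fun s => midpoint ℝ (circleCurve s) (gammaCurve q s))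
        ((2 : ℂ)⁻¹ * (I * circleCurve t + -I * circleCurve t * relDir q t ^ 2)) t := by
      have := ((hasDerivAt_circleCurve t).add (hasDerivAt_gammaCurve h0 h1 t)).const_mul (2 : ℂ)⁻¹
      have hfun : (fun s => midpoint ℝ (circleCurve s) (gammaCurve q s)) =
          fun s => (2 : ℂ)⁻¹ * (circleCurve s + gammaCurve q s) := by
        funext s
        exact midpoint_eq_inv_two_mul _ _
      rw [hfun]
      exact this
    rw [hd.deriv, gammaCurve_sub_circleCurve, Complex.real_smul]
    have hw := mul_conj_of_norm_eq_one (norm_relDir h0 h1 t)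
    have him : ((relDir q t).im : ℂ) = (relDir q t - conj (relDir q t)) / (2 * I) := by
      rw [Complex.im_eq_sub_conj]
    push_cast
    rw [him]
    have h2 := one_add_sq_ne_zero q
    have h3 : (q : ℂ) ≠ 0 := by exact_mod_cast h0.ne'
    have hI : (1 / (2 * I) : ℂ) = -I / 2 := by
      field_simp; simp
    rw [div_eq_mul_one_div _ (2 * I), hI]
    field_simp
    linear_combination -circleCurve t * hw

/-! ### Uniqueness. -/

/-- Uniqueness: the correspondence condition is a Riccati equation, linearized by a Möbius map. -/
lemma eq_gammaCurve {q : ℝ} (h0 : 0 < q) (h1 : q < 1) {Γ : ℝ → ℂ} (h : InBicycleCorrespondence ((1 + q ^ 2) / q) circleCurve Γ)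
    (hΓ : Γ 0 = gammaCurve q 0) : Γ = gammaCurve q := by
  have h2 := one_add_sq_ne_zero q
  have h3 : (q : ℂ) ≠ 0 := by exact_mod_cast h0.ne'
  set κ : ℂ := (1 + q ^ 2) / q with hκ
  have hκ0 : κ ≠ 0 := div_ne_zero h2 h3
  have hκn : ‖κ‖ = (1 + q ^ 2) / q := by
    have : κ = (((1 + q ^ 2) / q : ℝ) : ℂ) := by rw [hκ]; push_cast; rfl
    rw [this, Complex.norm_real, Real.norm_of_nonneg (by positivity)]
  set w : ℝ → ℂ := fun t => κ⁻¹ * ((circleCurve t)⁻¹ * Γ t - 1) with hw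
  have hΓw : ∀ t, Γ t = circleCurve t * (1 + κ * w t) := by
    intro t
    simp only [hw]
    have := circleCurve_ne_zero t
    field_simp
    ring
  have hwn : ∀ t, ‖w t‖ = 1 := by
    intro t
    have := h.chord_length t
    rw [hΓw, show circleCurve t * (1 + κ * w t) - circleCurve t = circleCurve t * (κ * w t) by ring,
      norm_mul, norm_mul, norm_circleCurve, hκn, one_mul] at this
    have hpos : (1 + q ^ 2) / q ≠ 0 := by positivity
    exact mul_left_cancel₀ hpos (by rw [this, mul_one])
  have hdw : Differentiable ℝ w := by
    intro t
    have h4 : DifferentiableAt ℝ Γ t := h.smooth_right.differentiable (by simp) t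
    have h5 := (hasDerivAt_circleCurve t).differentiableAt.inv (circleCurve_ne_zero t)
    exact ((h5.mul h4).sub_const 1).const_mul _
  clear_value w κ
  have hdw' : ∀ t, HasDerivAt w (-I * (w t + q) * (1 + q * w t) / (1 + q ^ 2)) t := by
    intro t
    have hd := (hdw t).hasDerivAt
    set w' := deriv w t
    have hww : ∀ s, w s * conj (w s) = 1 := fun s => mul_conj_of_norm_eq_one (hwn s)
    have hort : w' * conj (w t) + w t * conj w' = 0 := by
      have e1 := hd.mul hd.star
      have e2 : (w * fun s => star (w s)) = fun _ => (1 : ℂ) := by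
        funext s; exact hww s
      rw [e2] at e1
      exact e1.unique (hasDerivAt_const t (1 : ℂ))
    obtain ⟨c, hc⟩ := h.midpoint_tangent t
    have hmid : HasDerivAt (fun s => midpoint ℝ (circleCurve s) (Γ s))
        (I * circleCurve t * (1 + κ / 2 * w t) + circleCurve t * (κ / 2 * w')) t := by
      have := (hasDerivAt_circleCurve t).mul ((hd.const_mul (κ / 2)).const_add 1)
      have hfun : (fun s => midpoint ℝ (circleCurve s) (Γ s)) =
          fun s => circleCurve s * (1 + κ / 2 * w s) := by
        funext s
        rw [midpoint_eq_inv_two_mul, hΓw s]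
        ring
      rw [hfun]
      exact this
    rw [hmid.deriv, hΓw, Complex.real_smul] at hc
    have hc1 : I * (1 + κ / 2 * w t) + κ / 2 * w' = c * κ * w t := by
      apply mul_left_cancel₀ (circleCurve_ne_zero t)
      linear_combination hc
    have hκc : conj κ = κ := by simp [hκ]
    have hc2 := congrArg conj hc1
    simp only [map_add, map_mul, map_one, map_div₀, Complex.conj_I, hκc, Complex.conj_ofReal,
      map_ofNat] at hc2
    -- Subtracting `w²` times the conjugate equation eliminates the unknown real factor `c`; `hort`,
    -- from `|w| = 1`, trades `conj w'` for `w'`.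
    have hfin : κ * w' = -I * (1 + κ * w t + w t ^ 2) := by
      have hwt := hww t
      linear_combination hc1 - (w t)^2 * hc2 + (κ / 2 * w t) * hort +
        (-κ / 2 * w' - c * κ * w t - I * κ / 2 * w t) * hwt
    have : w' = -I * (w t + q) * (1 + q * w t) / (1 + q ^ 2) := by
      apply mul_left_cancel₀ hκ0
      rw [hfin, hκ]
      field_simp
      ring
    rwa [← this]
  have hden : ∀ t, 1 + q * w t ≠ 0 := fun t => one_add_real_mul_ne_zero h0 h1 (hwn t)
  -- First integral: the Möbius image of `w` rotates at speed `-r`, and the last factor undoes the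
  -- rotation.
  set f : ℝ → ℂ := fun t => (w t + q) / (1 + q * w t) * circleCurve (angularSpeed q * t) with hf
  have hfd : ∀ t, HasDerivAt f 0 t := by
    intro t
    have hlin : HasDerivAt (fun t : ℝ => angularSpeed q * t) (angularSpeed q * 1) t :=
      (hasDerivAt_id t).const_mul _
    have hE := (hasDerivAt_circleCurve (angularSpeed q * t)).scomp t hlin
    have := (((hdw' t).add_const (q : ℂ)).div (((hdw' t).const_mul (q : ℂ)).const_add 1)
      (hden t)).mul hE
    refine HasDerivAt.congr_deriv (f := f) this ?_
    have hdt := hden t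
    simp only [Function.comp, Pi.div_apply, angularSpeed, Complex.real_smul]
    push_cast
    field_simp
    ring
  have hconst : ∀ t, f t = f 0 := fun t =>
    is_const_of_deriv_eq_zero (fun s => (hfd s).differentiableAt) (fun s => (hfd s).deriv) t 0
  have hw0 : w 0 = 1 := by
    have := hΓw 0
    rw [hΓ, gammaCurve, relDir_zero h1, circleCurve_zero] at this
    rw [← hκ] at this
    apply mul_left_cancel₀ hκ0
    linear_combination -this
  have hf0 : f 0 = 1 := by
    have := hden 0
    simp only [hf, hw0, mul_zero, circleCurve_zero, mul_one] at this ⊢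
    exact div_self this
  ext t
  rw [hΓw, gammaCurve]
  congr 3
  have hft := (hconst t).trans hf0
  simp only [hf] at hft
  have hinv : circleCurve (angularSpeed q * t) * circleCurve (-(angularSpeed q * t)) = 1 := by
    rw [← circleCurve_add, add_neg_cancel, circleCurve_zero]
  have hd := one_sub_real_mul_ne_zero h0 h1 (norm_circleCurve (-(angularSpeed q * t)))
  rw [relDir, discMap, eq_div_iff hd]
  have hdt := hden t
  rw [div_mul_eq_mul_div, div_eq_one_iff_eq hdt] at hft
  linear_combination circleCurve (-(angularSpeed q * t)) * hft - (w t + q) * hinv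

/-! ### Correspondence of the curve with its own shifts. -/

lemma circleCurve_two_mul_sub_one (x : ℝ) :
    circleCurve (2 * x) - 1 = circleCurve x * (2 * I * Real.sin x) := by
  have h : (2 * I * Real.sin x : ℂ) = circleCurve x - circleCurve (-x) := by
    simp only [circleCurve, Complex.exp_mul_I]
    push_cast
    rw [Complex.cos_neg, Complex.sin_neg]
    ring
  rw [h, two_mul, circleCurve_add, mul_sub, ← circleCurve_add x (-x), add_neg_cancel,
    circleCurve_zero]

/-- Up to a unit factor, the quantity deciding whether the shift by `s` is a correspondence. -/
lemma circleCurve_shift_identity (q r s : ℝ) :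
    circleCurve s * circleCurve (-(r * s)) - 1 - q ^ 2 * (circleCurve s - circleCurve (-(r * s))) =
      circleCurve ((s - r * s) / 2) * (2 * I) *
        ((Real.sin ((s - r * s) / 2) - q ^ 2 * Real.sin ((s + r * s) / 2) : ℝ) : ℂ) := by
  have h1 : circleCurve s * circleCurve (-(r * s)) - 1 =
      circleCurve ((s - r * s) / 2) * (2 * I * Real.sin ((s - r * s) / 2)) := by
    rw [← circleCurve_two_mul_sub_one, ← circleCurve_add]; congr 2; ring
  have h2 : circleCurve s - circleCurve (-(r * s)) =
      circleCurve ((s - r * s) / 2) * (2 * I * Real.sin ((s + r * s) / 2)) := by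
    have e : circleCurve ((s - r * s) / 2) =
        circleCurve (-(r * s)) * circleCurve ((s + r * s) / 2) := by
      rw [← circleCurve_add]; congr 1; ring
    rw [e, mul_assoc, ← circleCurve_two_mul_sub_one, mul_sub, ← circleCurve_add, mul_one]
    congr 2; ring
  rw [h1, h2]; push_cast; ring

/-- In a correspondence of unit speed curves each tangent is the other one reflected in the chord. -/
lemma InBicycleCorrespondence.chord_sq {d : ℝ} {Γ₁ Γ₂ T₁ T₂ : ℝ → ℂ}
    (h : InBicycleCorrespondence d Γ₁ Γ₂) (h₁ : ∀ t, HasDerivAt Γ₁ (T₁ t) t)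
    (h₂ : ∀ t, HasDerivAt Γ₂ (T₂ t) t) (hT : ∀ t, ‖T₁ t‖ = 1) (t : ℝ) :
    (Γ₂ t - Γ₁ t) ^ 2 = d ^ 2 * (T₁ t * T₂ t) := by
  have hcc : ∀ s, (Γ₂ s - Γ₁ s) * conj (Γ₂ s - Γ₁ s) = (d : ℂ) ^ 2 := by
    intro s
    rw [Complex.mul_conj, Complex.normSq_eq_norm_sq, h.chord_length]
    push_cast; rfl
  have hd := (h₂ t).sub (h₁ t)
  have hort : (T₂ t - T₁ t) * conj (Γ₂ t - Γ₁ t) + (Γ₂ t - Γ₁ t) * conj (T₂ t - T₁ t) = 0 := by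
    have e1 := hd.mul hd.star
    have e2 : ((Γ₂ - Γ₁) * fun s => star ((Γ₂ - Γ₁) s)) = fun _ => (d : ℂ) ^ 2 := by
      funext s; exact hcc s
    rw [e2] at e1
    exact e1.unique (hasDerivAt_const t _)
  obtain ⟨c, hc⟩ := h.midpoint_tangent t
  have hmid : HasDerivAt (fun s => midpoint ℝ (Γ₁ s) (Γ₂ s)) ((2 : ℂ)⁻¹ * (T₁ t + T₂ t)) t := by
    have hfun : (fun s => midpoint ℝ (Γ₁ s) (Γ₂ s)) = fun s => (2 : ℂ)⁻¹ * (Γ₁ s + Γ₂ s) := by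
      funext s
      exact midpoint_eq_inv_two_mul _ _
    rw [hfun]
    exact ((h₁ t).add (h₂ t)).const_mul _
  rw [hmid.deriv, Complex.real_smul] at hc
  have hc' := congrArg conj hc
  have hccs := hcc t
  have hTt := mul_conj_of_norm_eq_one (hT t)
  simp only [map_mul, map_sub, map_add, map_inv₀, map_ofNat, Complex.conj_ofReal] at hc' hort hccs
  -- The real factor `c` cancels between the midpoint equation and its conjugate; constancy of the
  -- chord length supplies the rest.
  have key : T₂ t * (conj (Γ₂ t) - conj (Γ₁ t)) = (Γ₂ t - Γ₁ t) * conj (T₁ t) := by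
    linear_combination (conj (Γ₂ t) - conj (Γ₁ t)) * hc - (Γ₂ t - Γ₁ t) * hc' + hort / 2
  linear_combination (-(Γ₂ t - Γ₁ t) * T₁ t) * key + (T₁ t * T₂ t) * hccs -
    (Γ₂ t - Γ₁ t) ^ 2 * hTt

lemma relDir_add (q s t : ℝ) : relDir q (t + s) =
    discMap q (circleCurve (-(angularSpeed q * t)) * circleCurve (-(angularSpeed q * s))) := by
  rw [relDir, ← circleCurve_add]; congr 2; ring

/-- Isolates the part of the chord that has the shape forced by `chord_sq`. The remainder is
proportional to a quantity depending only on `s`, which must vanish for a correspondence. -/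
lemma chord_gammaCurve {q : ℝ} (h0 : 0 < q) (h1 : q < 1) (s t : ℝ) :
    gammaCurve q (t + s) - gammaCurve q t =
      circleCurve t * (1 - circleCurve s) * (relDir q t * relDir q (t + s)) +
      circleCurve t * circleCurve (-(angularSpeed q * t)) * (1 - q ^ 2) *
        (circleCurve s * circleCurve (-(angularSpeed q * s)) - 1 -
          q ^ 2 * (circleCurve s - circleCurve (-(angularSpeed q * s)))) /
        (q * (1 - q * circleCurve (-(angularSpeed q * t))) *
          (1 - q * (circleCurve (-(angularSpeed q * t)) * circleCurve (-(angularSpeed q * s))))) := by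
  have hE := norm_circleCurve (-(angularSpeed q * t))
  have hσ := norm_circleCurve (-(angularSpeed q * s))
  have d1 := one_sub_real_mul_ne_zero h0 h1 hE
  have d2 := one_sub_real_mul_ne_zero h0 h1
    (E := circleCurve (-(angularSpeed q * t)) * circleCurve (-(angularSpeed q * s)))
    (by rw [norm_mul, hE, hσ, mul_one])
  have h3 : (q : ℂ) ≠ 0 := by exact_mod_cast h0.ne'
  rw [gammaCurve, gammaCurve, relDir_add, relDir, discMap, discMap, circleCurve_add]
  generalize circleCurve (-(angularSpeed q * t)) = E at *
  generalize circleCurve (-(angularSpeed q * s)) = σ at *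
  obtain ⟨F, hF⟩ : ∃ F, F = E * σ := ⟨_, rfl⟩
  rw [← hF] at d2 ⊢
  field_simp
  rw [hF]
  ring

lemma angularSpeed_pos {q : ℝ} (h0 : 0 < q) (h1 : q < 1) : 0 < angularSpeed q :=
  div_pos (by nlinarith) (by positivity)

lemma shift_eq_zero_of_inBicycleCorrespondence {q d s : ℝ} (h0 : 0 < q) (h1 : q < 1)
    (h : InBicycleCorrespondence d (gammaCurve q) (fun t => gammaCurve q (t + s))) :
    circleCurve s ≠ 1 ∧ circleCurve s * circleCurve (-(angularSpeed q * s)) - 1 -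
          q ^ 2 * (circleCurve s - circleCurve (-(angularSpeed q * s))) = 0 := by
  have h3 : (q : ℂ) ≠ 0 := by exact_mod_cast h0.ne'
  have hr := angularSpeed_pos h0 h1
  have hsq := h.chord_sq (hasDerivAt_gammaCurve h0 h1)
    (fun t => (hasDerivAt_gammaCurve h0 h1 (t + s)).comp_add_const t s)
    (fun t => by simp [norm_circleCurve, norm_relDir h0 h1])
  -- A square root of the constant in `chord_sq`: the two tangents contribute `(-i)² e^{is}`. The
  -- sign of the root cannot change along the connected line.
  set ν : ℂ := I * d * circleCurve (s / 2) with hν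
  have hν0 : ν ≠ 0 := mul_ne_zero (mul_ne_zero I_ne_zero (by exact_mod_cast h.pos.ne'))
    (circleCurve_ne_zero _)
  have hhalf : circleCurve (s / 2) ^ 2 = circleCurve s := by
    rw [sq, ← circleCurve_add]; congr 1; ring
  have hsgn := isPreconnected_univ.eq_or_eq_neg_of_sq_eq
    (f := fun t => gammaCurve q (t + s) - gammaCurve q t)
    (g := fun t => ν * (circleCurve t * (relDir q t * relDir q (t + s))))
    (by
      have := (contDiff_gammaCurve h0 h1).continuous
      fun_prop)
    (by
      have := (contDiff_relDir h0 h1).continuous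
      have := contDiff_circleCurve.continuous
      fun_prop)
    (by
      intro t _
      have := hsq t
      simp only [Pi.pow_apply]
      rw [this, circleCurve_add, hν, mul_pow, mul_pow, mul_pow, hhalf]
      ring)
    (by
      intro t _
      exact mul_ne_zero hν0 (mul_ne_zero (circleCurve_ne_zero _)
        (mul_ne_zero (relDir_ne_zero h0 h1 _) (relDir_ne_zero h0 h1 _))))
  obtain ⟨μ, hμ0, hμ⟩ : ∃ μ : ℂ, μ ≠ 0 ∧ ∀ t, gammaCurve q (t + s) - gammaCurve q t =
      μ * (circleCurve t * (relDir q t * relDir q (t + s))) := by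
    rcases hsgn with hs | hs
    · exact ⟨ν, hν0, fun t => hs (Set.mem_univ t)⟩
    · refine ⟨-ν, neg_ne_zero.mpr hν0, fun t => ?_⟩
      have := hs (Set.mem_univ t)
      simp only [Pi.neg_apply] at this
      rw [this]; ring
  set σ := circleCurve (-(angularSpeed q * s)) with hσ
  set K := circleCurve s * σ - 1 - q ^ 2 * (circleCurve s - σ) with hK
  have hσn : ‖σ‖ = 1 := norm_circleCurve _
  have key : ∀ t, (μ - (1 - circleCurve s)) * q * (circleCurve (-(angularSpeed q * t)) - q) *
      (circleCurve (-(angularSpeed q * t)) * σ - q) =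
      (1 - q ^ 2) * K * circleCurve (-(angularSpeed q * t)) := by
    intro t
    have e := hμ t
    rw [chord_gammaCurve h0 h1, ← hσ, ← hK, relDir_add, relDir, discMap, discMap, ← hσ] at e
    have hE := norm_circleCurve (-(angularSpeed q * t))
    have d1 := one_sub_real_mul_ne_zero h0 h1 hE
    have d2 := one_sub_real_mul_ne_zero h0 h1 (E := circleCurve (-(angularSpeed q * t)) * σ)
      (by rw [norm_mul, hE, hσn, mul_one])
    have hz := circleCurve_ne_zero t
    generalize circleCurve (-(angularSpeed q * t)) = E at *
    clear_value K σ
    obtain ⟨F, hF⟩ : ∃ F, F = E * σ := ⟨_, rfl⟩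
    rw [← hF] at d2 e ⊢
    rw [mul_comm (q : ℂ)] at d1
    field_simp at e
    linear_combination -e
  have k1 := key 0
  -- The times 0 and `-π/r` give `E = 1` and `E = -1`; adding cancels the right side, which is
  -- linear in `E`, and leaves the nonzero factor `2q(σ + q²)`.
  have k2 := key (-(Real.pi / angularSpeed q))
  have e2 : -(angularSpeed q * -(Real.pi / angularSpeed q)) = Real.pi := by
    field_simp
  rw [e2, circleCurve_pi] at k2
  rw [mul_zero, neg_zero, circleCurve_zero] at k1
  have hM : (μ - (1 - circleCurve s)) * (2 * q * (σ + (q ^ 2 : ℝ))) = 0 := by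
    push_cast
    linear_combination k1 + k2
  have hne := add_real_ne_zero (q := q ^ 2) (by positivity) (by nlinarith) hσn
  have hM0 : μ - (1 - circleCurve s) = 0 := by
    rcases mul_eq_zero.mp hM with h | h
    · exact h
    · exact absurd h (mul_ne_zero (mul_ne_zero two_ne_zero h3) hne)
  constructor
  · intro hs
    rw [hs] at hM0
    apply hμ0
    simpa using hM0
  · rw [hM0] at k1
    have hq2 : (1 - (q : ℂ) ^ 2) ≠ 0 := by
      have : (1 - q ^ 2 : ℝ) ≠ 0 := by nlinarith
      exact_mod_cast this
    have : (1 - (q : ℂ) ^ 2) * K = 0 := by linear_combination -k1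
    exact (mul_eq_zero.mp this).resolve_left hq2

lemma inBicycleCorrespondence_shift {q s : ℝ} (h0 : 0 < q) (h1 : q < 1) (hs : circleCurve s ≠ 1)
    (hK : circleCurve s * circleCurve (-(angularSpeed q * s)) - 1 -
          q ^ 2 * (circleCurve s - circleCurve (-(angularSpeed q * s))) = 0) :
    InBicycleCorrespondence ‖1 - circleCurve s‖ (gammaCurve q)
      (fun t => gammaCurve q (t + s)) := by
  have hchord : ∀ t, gammaCurve q (t + s) - gammaCurve q t =
      circleCurve t * (1 - circleCurve s) * (relDir q t * relDir q (t + s)) := by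
    intro t
    rw [chord_gammaCurve h0 h1, hK, mul_zero, zero_div, add_zero]
  have hsm := contDiff_gammaCurve h0 h1
  have hpos : 0 < ‖1 - circleCurve s‖ := norm_pos_iff.mpr (sub_ne_zero.mpr (Ne.symm hs))
  refine ⟨hpos, hsm, hsm.comp (by fun_prop), fun t => ?_, fun t => ?_⟩
  · rw [hchord, norm_mul, norm_mul, norm_mul, norm_circleCurve, norm_relDir h0 h1,
      norm_relDir h0 h1]
    ring
  · have hmid : HasDerivAt (fun t => midpoint ℝ (gammaCurve q t) (gammaCurve q (t + s)))
        ((2 : ℂ)⁻¹ * (-I * circleCurve t * relDir q t ^ 2 +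
          -I * circleCurve (t + s) * relDir q (t + s) ^ 2)) t := by
      have hfun : (fun t => midpoint ℝ (gammaCurve q t) (gammaCurve q (t + s))) =
          fun t => (2 : ℂ)⁻¹ * (gammaCurve q t + gammaCurve q (t + s)) := by
        funext s
        exact midpoint_eq_inv_two_mul _ _
      rw [hfun]
      exact ((hasDerivAt_gammaCurve h0 h1 t).add
        ((hasDerivAt_gammaCurve h0 h1 (t + s)).comp_add_const t s)).const_mul _
    have hS := circleCurve_two_mul_sub_one (s / 2)
    rw [show 2 * (s / 2) = s by ring] at hS
    have hhalf : circleCurve (s / 2) ^ 2 = circleCurve s := by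
      rw [sq, ← circleCurve_add]; congr 1; ring
    have hsin : Real.sin (s / 2) ≠ 0 := by
      intro h
      rw [h] at hS
      apply hs
      rw [Complex.ofReal_zero, mul_zero, mul_zero] at hS
      exact sub_eq_zero.mp hS
    set a := circleCurve (s / 2) with ha
    set w₁ := relDir q t with hw₁
    set w₂ := relDir q (t + s) with hw₂
    have n₁ := mul_conj_of_norm_eq_one (norm_relDir h0 h1 t)
    have n₂ := mul_conj_of_norm_eq_one (norm_relDir h0 h1 (t + s))
    have na := circleCurve_mul_conj (s / 2)
    rw [← hw₁] at n₁
    rw [← hw₂] at n₂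
    rw [← ha] at na
    -- With `a = e^{is/2}`, `w₁² + a² w₂² = 2 a w₁ w₂ Re(a w₂ conj w₁)`, while the chord is `-2i
    -- sin(s/2) e^{it} a w₁ w₂`.
    refine ⟨(a * w₂ * conj w₁).re / (2 * Real.sin (s / 2)), ?_⟩
    have hre : ((a * w₂ * conj w₁).re : ℂ) =
        (a * w₂ * conj w₁ + conj a * conj w₂ * w₁) / 2 := by
      rw [Complex.re_eq_add_conj]
      simp
    have hsinc : (Real.sin (s / 2) : ℂ) ≠ 0 := by exact_mod_cast hsin
    rw [hmid.deriv, hchord, ← hw₁, ← hw₂, Complex.real_smul, circleCurve_add]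
    have hS' : 1 - circleCurve s = -(a * (2 * I * Real.sin (s / 2))) := by linear_combination -hS
    rw [hS']
    push_cast at hre hsinc ⊢
    rw [hre, ← hhalf]
    generalize circleCurve t = z at *
    field_simp
    linear_combination (a^2 * w₂^2 * z) * n₁ + (w₁^2 * z) * na + (w₁^2 * a * conj a * z) * n₂

theorem exists_inBicycleCorrespondence_shift_iff {q : ℝ} (h0 : 0 < q) (h1 : q < 1) (s : ℝ) :
    (∃ d, InBicycleCorrespondence d (gammaCurve q) (fun t => gammaCurve q (t + s))) ↔
      circleCurve s ≠ 1 ∧ Real.sin ((s - angularSpeed q * s) / 2) =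
        q ^ 2 * Real.sin ((s + angularSpeed q * s) / 2) := by
  have hiff : circleCurve s * circleCurve (-(angularSpeed q * s)) - 1 -
        q ^ 2 * (circleCurve s - circleCurve (-(angularSpeed q * s))) = 0 ↔
      Real.sin ((s - angularSpeed q * s) / 2) =
        q ^ 2 * Real.sin ((s + angularSpeed q * s) / 2) := by
    rw [circleCurve_shift_identity, mul_eq_zero, or_iff_right (mul_ne_zero (circleCurve_ne_zero _)
      (mul_ne_zero two_ne_zero I_ne_zero)), Complex.ofReal_eq_zero, sub_eq_zero]
  rw [← hiff]
  exact ⟨fun ⟨d, h⟩ => shift_eq_zero_of_inBicycleCorrespondence h0 h1 h,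
    fun h => ⟨_, inBicycleCorrespondence_shift h0 h1 h.1 h.2⟩⟩

/-! ### Forms of the tangent equation. -/

/-- If `kρ` and `nρ` were both integers, Bézout would make `ρ` an integer. -/
lemma sin_mul_pi_mul_ne_zero {k n : ℕ} (hcop : Nat.Coprime k n) {ρ : ℝ}
    (hρ : ρ ∈ Set.Ioo (0 : ℝ) 1) (hB : Real.sin (k * Real.pi * ρ) = 0) :
    Real.sin (n * Real.pi * ρ) ≠ 0 := by
  intro hA
  obtain ⟨a, ha⟩ := Real.sin_eq_zero_iff.mp hA
  obtain ⟨b, hb⟩ := Real.sin_eq_zero_iff.mp hB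
  have hpi := Real.pi_pos.ne'
  have ha' : (a : ℝ) = n * ρ := mul_right_cancel₀ hpi (by linear_combination ha)
  have hb' : (b : ℝ) = k * ρ := mul_right_cancel₀ hpi (by linear_combination hb)
  obtain ⟨u, v, huv⟩ := Nat.isCoprime_iff_coprime.mpr hcop
  have huv' : (u * k + v * n : ℝ) = 1 := by exact_mod_cast huv
  have hint : ρ = ((u * b + v * a : ℤ) : ℝ) := by
    push_cast; rw [ha', hb']; linear_combination -ρ * huv'
  rw [hint] at hρ
  have h1 : 0 < u * b + v * a := by exact_mod_cast hρ.1
  have h2 : u * b + v * a < 1 := by exact_mod_cast hρ.2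
  omega

/-- Here `2kρ` and `2nρ` are odd integers, so by Bézout `2ρ` is an integer in `(0, 2)`. -/
lemma eq_half_of_cos_eq_zero {k n : ℕ} (hcop : Nat.Coprime k n) {ρ : ℝ}
    (hρ : ρ ∈ Set.Ioo (0 : ℝ) 1) (hB : Real.cos (k * Real.pi * ρ) = 0)
    (hA : Real.cos (n * Real.pi * ρ) = 0) : ρ = 1 / 2 ∧ Odd k ∧ Odd n := by
  obtain ⟨a, ha⟩ := Real.cos_eq_zero_iff.mp hA
  obtain ⟨b, hb⟩ := Real.cos_eq_zero_iff.mp hB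
  have hpi := Real.pi_pos.ne'
  have ha' : (2 * a + 1 : ℝ) = n * (2 * ρ) := mul_right_cancel₀ hpi (by linear_combination -2 * ha)
  have hb' : (2 * b + 1 : ℝ) = k * (2 * ρ) := mul_right_cancel₀ hpi (by linear_combination -2 * hb)
  obtain ⟨u, v, huv⟩ := Nat.isCoprime_iff_coprime.mpr hcop
  have huv' : (u * k + v * n : ℝ) = 1 := by exact_mod_cast huv
  have hint : 2 * ρ = ((u * (2 * b + 1) + v * (2 * a + 1) : ℤ) : ℝ) := by
    push_cast; rw [ha', hb']; linear_combination -(2 * ρ) * huv'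
  have h1 : 0 < u * (2 * b + 1) + v * (2 * a + 1) := by
    have : (0 : ℝ) < ((u * (2 * b + 1) + v * (2 * a + 1) : ℤ) : ℝ) := by
      rw [← hint]; linarith [hρ.1]
    exact_mod_cast this
  have h2 : u * (2 * b + 1) + v * (2 * a + 1) < 2 := by
    have : ((u * (2 * b + 1) + v * (2 * a + 1) : ℤ) : ℝ) < 2 := by
      rw [← hint]; linarith [hρ.2]
    exact_mod_cast this
  have h3 : u * (2 * b + 1) + v * (2 * a + 1) = 1 := by omega
  rw [h3, Int.cast_one] at hint
  rw [hint, mul_one] at ha' hb'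
  refine ⟨by linarith, ?_, ?_⟩
  · have : (k : ℤ) = 2 * b + 1 := by exact_mod_cast hb'.symm
    rw [← Int.odd_coe_nat]
    exact ⟨b, this⟩
  · have : (n : ℤ) = 2 * a + 1 := by exact_mod_cast ha'.symm
    rw [← Int.odd_coe_nat]
    exact ⟨a, this⟩

lemma cos_odd_mul_pi_mul_half {m : ℕ} (hm : Odd m) : Real.cos (m * Real.pi * (1 / 2)) = 0 := by
  obtain ⟨j, rfl⟩ := hm
  exact Real.cos_eq_zero_iff.mpr ⟨j, by push_cast; ring⟩

/-- The equation `n tan (kπρ) = k tan (nπρ)` cleared of denominators. -/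
lemma solvesTanEquation_iff {k n : ℕ} (hk : 1 ≤ k) (hkn : k < n) (hcop : Nat.Coprime k n) {ρ : ℝ}
    (hρ : ρ ∈ Set.Ioo (0 : ℝ) 1) : SolvesTanEquation k n ρ ↔
      (n : ℝ) * (Real.sin (k * Real.pi * ρ) * Real.cos (n * Real.pi * ρ)) =
        k * (Real.sin (n * Real.pi * ρ) * Real.cos (k * Real.pi * ρ)) := by
  have hk0 : (k : ℝ) ≠ 0 := by exact_mod_cast (by omega : k ≠ 0)
  have hn0 : (n : ℝ) ≠ 0 := by exact_mod_cast (by omega : n ≠ 0)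
  constructor
  · rintro (⟨hB, hA, h⟩ | ⟨rfl, hko, hno⟩)
    · rw [Real.tan_eq_sin_div_cos, Real.tan_eq_sin_div_cos] at h
      field_simp at h
      linear_combination h
    · rw [cos_odd_mul_pi_mul_half hko, cos_odd_mul_pi_mul_half hno]; ring
  · intro h
    by_cases hA : Real.cos (n * Real.pi * ρ) = 0
    · have hsA : Real.sin (n * Real.pi * ρ) ≠ 0 := by
        intro h0
        have := Real.sin_sq_add_cos_sq (n * Real.pi * ρ)
        rw [hA, h0] at this; norm_num at this
      have hB : Real.cos (k * Real.pi * ρ) = 0 := by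
        rw [hA, mul_zero, mul_zero] at h
        simpa [hk0, hsA] using h.symm
      exact Or.inr (eq_half_of_cos_eq_zero hcop hρ hB hA)
    · by_cases hB : Real.cos (k * Real.pi * ρ) = 0
      · rw [hB, mul_zero, mul_zero] at h
        have hsB : Real.sin (k * Real.pi * ρ) = 0 := by simpa [hn0, hA] using h
        have := Real.sin_sq_add_cos_sq (k * Real.pi * ρ)
        rw [hB, hsB] at this; norm_num at this
      · refine Or.inl ⟨hB, hA, ?_⟩
        rw [Real.tan_eq_sin_div_cos, Real.tan_eq_sin_div_cos]
        field_simp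
        linear_combination h

/-- Ensures that a solution gives a chord of positive length: `e^{2πinρ} ≠ 1`. -/
lemma sin_mul_pi_mul_ne_zero_of_solvesTanEquation {k n : ℕ} (hk : 1 ≤ k) (hkn : k < n)
    (hcop : Nat.Coprime k n) {ρ : ℝ} (hρ : ρ ∈ Set.Ioo (0 : ℝ) 1) (h : SolvesTanEquation k n ρ) :
    Real.sin (n * Real.pi * ρ) ≠ 0 := by
  intro hA
  have hn0 : (n : ℝ) ≠ 0 := by exact_mod_cast (by omega : n ≠ 0)
  have h' := (solvesTanEquation_iff hk hkn hcop hρ).mp h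
  have hcA : Real.cos (n * Real.pi * ρ) ≠ 0 := by
    intro h0
    have := Real.sin_sq_add_cos_sq (n * Real.pi * ρ)
    rw [hA, h0] at this; norm_num at this
  rw [hA, zero_mul, mul_zero] at h'
  exact sin_mul_pi_mul_ne_zero hcop hρ (by simpa [hn0, hcA] using h') hA

lemma solvesTanEquation_iff_sin {k n : ℕ} (hk : 1 ≤ k) (hkn : k < n) (hcop : Nat.Coprime k n)
    {ρ : ℝ} (hρ : ρ ∈ Set.Ioo (0 : ℝ) 1) : SolvesTanEquation k n ρ ↔
      ((n : ℝ) + k) * Real.sin ((n - k) * (Real.pi * ρ)) =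
        (n - k) * Real.sin ((n + k) * (Real.pi * ρ)) := by
  rw [solvesTanEquation_iff hk hkn hcop hρ,
    show ((n : ℝ) - k) * (Real.pi * ρ) = n * Real.pi * ρ - k * Real.pi * ρ by ring,
    show ((n : ℝ) + k) * (Real.pi * ρ) = n * Real.pi * ρ + k * Real.pi * ρ by ring,
    Real.sin_sub, Real.sin_add]
  constructor <;> intro h
  · linear_combination -2 * h
  · linear_combination -h / 2

/-! ### Counting the solutions. -/

/-- A continuous lift of the angle whose sine vanishes exactly at the solutions. -/
noncomputable def liftedAngle (k n : ℕ) (x : ℝ) : ℝ :=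
  (n - k) * x -
    Real.arctan ((n - k) * Real.sin (2 * k * x) / (n + k - (n - k) * Real.cos (2 * k * x)))

lemma liftedAngle_den_pos {k n : ℕ} (hk : 1 ≤ k) (hkn : k < n) (y : ℝ) :
    0 < (n + k - (n - k) * Real.cos y : ℝ) := by
  have h1 : (1 : ℝ) ≤ k := by exact_mod_cast hk
  have h2 : (k : ℝ) < n := by exact_mod_cast hkn
  nlinarith [Real.cos_le_one y]

lemma hasDerivAt_liftedAngle {k n : ℕ} (hk : 1 ≤ k) (hkn : k < n) (x : ℝ) :
    HasDerivAt (liftedAngle k n)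
      (2 * n * (n - k) * (n + k) * (1 - Real.cos (2 * k * x)) /
        ((n + k - (n - k) * Real.cos (2 * k * x)) ^ 2 + ((n - k) * Real.sin (2 * k * x)) ^ 2)) x := by
  have hD := liftedAngle_den_pos hk hkn (2 * k * x)
  have hlin : HasDerivAt (fun x : ℝ => 2 * k * x) (2 * k * 1) x := (hasDerivAt_id x).const_mul _
  have hs := (hlin.sin).const_mul ((n : ℝ) - k)
  have hc := ((hlin.cos).const_mul ((n : ℝ) - k)).const_sub ((n : ℝ) + k)
  have := ((hasDerivAt_id x).const_mul ((n : ℝ) - k)).sub (hs.div hc hD.ne').arctan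
  refine HasDerivAt.congr_deriv (f := liftedAngle k n) this ?_
  have hsc := Real.sin_sq_add_cos_sq (2 * k * x)
  simp only [Pi.div_apply]
  generalize Real.sin (2 * k * x) = S at *
  generalize Real.cos (2 * k * x) = C at *
  have hD2 : (n + k - (n - k) * C : ℝ) ^ 2 + ((n - k) * S) ^ 2 ≠ 0 := by positivity
  have hD0 := hD.ne'
  have hS : S ^ 2 = 1 - C ^ 2 := by linarith
  rw [mul_pow, hS] at hD2 ⊢
  rw [div_pow, mul_pow, hS]
  have hD3 : 1 + (n - k : ℝ) ^ 2 * (1 - C ^ 2) / (n + k - (n - k) * C) ^ 2 =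
      ((n + k - (n - k) * C) ^ 2 + (n - k) ^ 2 * (1 - C ^ 2)) / (n + k - (n - k) * C) ^ 2 := by
    field_simp
  rw [hD3]
  field_simp
  rw [hS]
  ring

/-- The derivative is nonnegative and vanishes only where `cos(2kx) = 1`. Were the function constant
on an interval, `sin(2kx)` would vanish there, and so would its derivative `2k cos(2kx) = 2k`. -/
lemma strictMono_liftedAngle {k n : ℕ} (hk : 1 ≤ k) (hkn : k < n) :
    StrictMono (liftedAngle k n) := by
  have hk1 : (1 : ℝ) ≤ k := by exact_mod_cast hk
  have hkn' : (k : ℝ) < n := by exact_mod_cast hkn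
  have hd := hasDerivAt_liftedAngle hk hkn
  have hden : ∀ x : ℝ, 0 < (n + k - (n - k) * Real.cos (2 * k * x)) ^ 2 +
      ((n - k) * Real.sin (2 * k * x)) ^ 2 := by
    intro x
    have := liftedAngle_den_pos hk hkn (2 * k * x)
    positivity
  have hnum : (0 : ℝ) < 2 * n * (n - k) * (n + k) := by
    have : (0 : ℝ) < n - k := by linarith
    have : (0 : ℝ) < n := by linarith
    positivity
  have hmono : Monotone (liftedAngle k n) := by
    refine monotone_of_deriv_nonneg (fun x => (hd x).differentiableAt) fun x => ?_
    rw [(hd x).deriv]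
    exact div_nonneg (mul_nonneg hnum.le (by linarith [Real.cos_le_one (2 * k * x)])) (hden x).le
  refine hmono.strictMono_of_injective ?_
  intro a b hab
  by_contra hne
  wlog hlt : a < b generalizing a b
  · exact this hab.symm (Ne.symm hne) (lt_of_le_of_ne (not_lt.mp hlt) (Ne.symm hne))
  have hconst : ∀ x ∈ Set.Ioo a b, liftedAngle k n x = liftedAngle k n a := fun x hx =>
    le_antisymm (hab ▸ hmono hx.2.le) (hmono hx.1.le)
  have hcos : ∀ x ∈ Set.Ioo a b, Real.cos (2 * k * x) = 1 := by
    intro x hx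
    have hev : liftedAngle k n =ᶠ[nhds x] fun _ => liftedAngle k n a :=
      Filter.eventually_of_mem (Ioo_mem_nhds hx.1 hx.2) hconst
    have h0 := (hd x).unique ((hasDerivAt_const x _).congr_of_eventuallyEq hev)
    rw [div_eq_zero_iff, or_iff_left (hden x).ne', mul_eq_zero, or_iff_right hnum.ne'] at h0
    linarith
  have hmem : (a + b) / 2 ∈ Set.Ioo a b := ⟨by linarith, by linarith⟩
  set c := (a + b) / 2
  have hsin : ∀ x ∈ Set.Ioo a b, Real.sin (2 * k * x) = 0 := by
    intro x hx
    have := Real.sin_sq_add_cos_sq (2 * k * x)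
    rw [hcos x hx] at this
    have : Real.sin (2 * k * x) ^ 2 = 0 := by linarith
    exact pow_eq_zero_iff two_ne_zero |>.mp this
  have hev : (fun x : ℝ => Real.sin (2 * k * x)) =ᶠ[nhds c] fun _ => 0 :=
    Filter.eventually_of_mem (Ioo_mem_nhds hmem.1 hmem.2) hsin
  have hlin : HasDerivAt (fun x : ℝ => 2 * k * x) (2 * k * 1) c := (hasDerivAt_id c).const_mul _
  have h0 := hlin.sin.unique ((hasDerivAt_const c (0 : ℝ)).congr_of_eventuallyEq hev)
  rw [hcos c hmem] at h0
  linarith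

/-- The difference of the two sides is the imaginary part of `e^{i(n-k)x}((n + k) - (n -
k)e^{2ikx})`. The second factor has positive real part, so an arctangent gives its argument. -/
lemma sin_liftedAngle_eq_zero_iff {k n : ℕ} (hk : 1 ≤ k) (hkn : k < n) (x : ℝ) :
    Real.sin (liftedAngle k n x) = 0 ↔
      ((n : ℝ) + k) * Real.sin ((n - k) * x) = (n - k) * Real.sin ((n + k) * x) := by
  have hD := liftedAngle_den_pos hk hkn (2 * k * x)
  rw [liftedAngle, Real.sin_sub, Real.sin_arctan, Real.cos_arctan,
    show ((n : ℝ) + k) * x = (n - k) * x + 2 * k * x by ring, Real.sin_add]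
  set y := (n - k) * Real.sin (2 * k * x) / (n + k - (n - k) * Real.cos (2 * k * x)) with hy
  have hs : 0 < Real.sqrt (1 + y ^ 2) := Real.sqrt_pos.mpr (by positivity)
  have hyD : y * (n + k - (n - k) * Real.cos (2 * k * x)) = (n - k) * Real.sin (2 * k * x) :=
    div_mul_cancel₀ _ hD.ne'
  rw [show Real.sin ((n - k) * x) * (1 / Real.sqrt (1 + y ^ 2)) -
      Real.cos ((n - k) * x) * (y / Real.sqrt (1 + y ^ 2)) =
      (Real.sin ((n - k) * x) - Real.cos ((n - k) * x) * y) / Real.sqrt (1 + y ^ 2) by ring,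
    div_eq_zero_iff, or_iff_left hs.ne']
  constructor
  · intro h
    linear_combination (n + k - (n - k) * Real.cos (2 * k * x)) * h +
      Real.cos ((n - k) * x) * hyD
  · intro h
    apply mul_right_cancel₀ hD.ne'
    linear_combination h - Real.cos ((n - k) * x) * hyD

lemma liftedAngle_zero (k n : ℕ) : liftedAngle k n 0 = 0 := by simp [liftedAngle]

lemma liftedAngle_pi (k n : ℕ) : liftedAngle k n Real.pi = (n - k) * Real.pi := by
  have : Real.sin (2 * k * Real.pi) = 0 := by
    have := Real.sin_nat_mul_pi (2 * k)
    push_cast at this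
    exact this
  simp [liftedAngle, this]

/-- The number of solutions in `(0, 1)` of `n tan (kπρ) = k tan (nπρ)`. -/
theorem encard_solvesTanEquation {k n : ℕ} (hk : 1 ≤ k) (hkn : k < n) (hcop : Nat.Coprime k n) :
    {ρ : ℝ | ρ ∈ Set.Ioo (0 : ℝ) 1 ∧ SolvesTanEquation k n ρ}.encard = ((n - k - 1 : ℕ) : ℕ∞) := by
  have hpi := Real.pi_pos
  have hmono := strictMono_liftedAngle hk hkn
  have hcont : Continuous (liftedAngle k n) :=
    continuous_iff_continuousAt.mpr fun x => (hasDerivAt_liftedAngle hk hkn x).continuousAt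
  have hinj : Function.Injective (fun ρ : ℝ => liftedAngle k n (Real.pi * ρ)) :=
    hmono.injective.comp (mul_right_injective₀ hpi.ne')
  have hcast : ((n - k : ℕ) : ℝ) = n - k := Nat.cast_sub hkn.le
  have hiff : ∀ ρ ∈ Set.Ioo (0 : ℝ) 1, (SolvesTanEquation k n ρ ↔
      ∃ j : ℤ, (j : ℝ) * Real.pi = liftedAngle k n (Real.pi * ρ)) := by
    intro ρ hρ
    rw [solvesTanEquation_iff_sin hk hkn hcop hρ, ← sin_liftedAngle_eq_zero_iff hk hkn,
      Real.sin_eq_zero_iff]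
  have himage : (fun ρ : ℝ => liftedAngle k n (Real.pi * ρ)) ''
      {ρ : ℝ | ρ ∈ Set.Ioo (0 : ℝ) 1 ∧ SolvesTanEquation k n ρ} =
      (fun j : ℕ => (j : ℝ) * Real.pi) '' (Finset.Ico 1 (n - k) : Finset ℕ) := by
    ext y
    simp only [Set.mem_image, Set.mem_ofPred_eq, Finset.coe_Ico, Set.mem_Ico]
    constructor
    · rintro ⟨ρ, ⟨hρ, hsol⟩, rfl⟩
      obtain ⟨j, hj⟩ := (hiff ρ hρ).mp hsol
      have hlo : 0 < liftedAngle k n (Real.pi * ρ) := by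
        rw [← liftedAngle_zero k n]
        exact hmono (mul_pos hpi hρ.1)
      have hhi : liftedAngle k n (Real.pi * ρ) < ((n - k : ℕ) : ℝ) * Real.pi := by
        rw [hcast, ← liftedAngle_pi k n]
        exact hmono (by nlinarith [hρ.2])
      rw [← hj] at hlo hhi
      have hj0 : 0 < j := by exact_mod_cast pos_of_mul_pos_left hlo hpi.le
      have hj1 : (j : ℝ) < (n - k : ℕ) := lt_of_mul_lt_mul_right hhi hpi.le
      lift j to ℕ using hj0.le
      refine ⟨j, ⟨by omega, by exact_mod_cast hj1⟩, by exact_mod_cast hj⟩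
    · rintro ⟨j, ⟨hj0, hj1⟩, rfl⟩
      have hmem : (j : ℝ) * Real.pi ∈
          Set.Ioo (liftedAngle k n 0) (liftedAngle k n Real.pi) := by
        rw [liftedAngle_zero, liftedAngle_pi, ← hcast]
        have h0 : (0 : ℝ) < j := by exact_mod_cast hj0
        have h1 : (j : ℝ) < (n - k : ℕ) := by exact_mod_cast hj1
        exact ⟨by positivity, mul_lt_mul_of_pos_right h1 hpi⟩
      obtain ⟨x, hx, hxj⟩ := intermediate_value_Ioo hpi.le hcont.continuousOn hmem
      have hxρ : Real.pi * (x / Real.pi) = x := by field_simp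
      have hρ : x / Real.pi ∈ Set.Ioo (0 : ℝ) 1 :=
        ⟨div_pos hx.1 hpi, (div_lt_one hpi).mpr hx.2⟩
      refine ⟨x / Real.pi, ⟨hρ, (hiff _ hρ).mpr ⟨j, ?_⟩⟩, ?_⟩
      · rw [hxρ, hxj]; push_cast; rfl
      · rw [hxρ, hxj]
  have hinj' : Function.Injective (fun j : ℕ => (j : ℝ) * Real.pi) :=
    (mul_left_injective₀ hpi.ne').comp Nat.cast_injective
  rw [← hinj.encard_image, himage, hinj'.encard_image, Set.encard_coe_eq_coe_finsetCard,
    Nat.card_Ico]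

/-! ### Specialization to angular speed `k/n`. -/

/-- The parameter of the disc map for which the direction has angular speed `k / n`. -/
noncomputable def discParam (k n : ℕ) : ℝ := Real.sqrt ((n - k) / (n + k))

lemma discParam_sq {k n : ℕ} (hkn : k < n) : discParam k n ^ 2 = (n - k) / (n + k) := by
  have h : (k : ℝ) < n := by exact_mod_cast hkn
  exact Real.sq_sqrt (div_nonneg (by linarith) (by positivity))

lemma discParam_pos {k n : ℕ} (hkn : k < n) : 0 < discParam k n := by
  have h : (k : ℝ) < n := by exact_mod_cast hkn
  have hk : (0 : ℝ) ≤ k := k.cast_nonneg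
  exact Real.sqrt_pos.mpr (div_pos (by linarith) (by linarith))

lemma discParam_lt_one {k n : ℕ} (hk : 1 ≤ k) (hkn : k < n) : discParam k n < 1 := by
  have h : (k : ℝ) < n := by exact_mod_cast hkn
  have hk : (1 : ℝ) ≤ k := by exact_mod_cast hk
  rw [discParam, Real.sqrt_lt' one_pos, one_pow, div_lt_one (by linarith)]
  linarith

lemma angularSpeed_discParam {k n : ℕ} (hkn : k < n) : angularSpeed (discParam k n) = k / n := by
  have hn : (0 : ℝ) < n := by exact_mod_cast (by omega : 0 < n)
  have hnk : (0 : ℝ) < n + k := by positivity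
  have h1 : 1 - ((n : ℝ) - k) / (n + k) = 2 * k / (n + k) := by field_simp; ring
  have h2 : 1 + ((n : ℝ) - k) / (n + k) = 2 * n / (n + k) := by field_simp; ring
  rw [angularSpeed, discParam_sq hkn, h1, h2]
  field_simp

/-- `(1 - q²)/(1 + q²) = k/n` and `2q/(1 + q²)` are the cosine and sine of one angle, so the root in
`bicycleLength` is the latter. -/
lemma two_mul_bicycleLength {k n : ℕ} (hk : 1 ≤ k) (hkn : k < n) :
    2 * bicycleLength k n = (1 + discParam k n ^ 2) / discParam k n := by
  have hq := discParam_pos hkn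
  have hq1 := discParam_lt_one hk hkn
  set q := discParam k n
  have h : 1 - ((k : ℝ) / n) ^ 2 = (2 * q / (1 + q ^ 2)) ^ 2 := by
    rw [← angularSpeed_discParam hkn, angularSpeed]
    field_simp
    ring
  rw [bicycleLength, h, Real.sqrt_sq (by positivity)]
  field_simp

lemma isGammaCurve_gammaCurve {k n : ℕ} (hk : 1 ≤ k) (hkn : k < n) :
    IsGammaCurve k n (gammaCurve (discParam k n)) where
  closed t := by
    have hn : (n : ℝ) ≠ 0 := by exact_mod_cast (by omega : n ≠ 0)
    have e1 : circleCurve (2 * Real.pi * n) = 1 := by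
      simpa using circleCurve_two_pi_mul n
    have e2 : circleCurve (-(k / n * (2 * Real.pi * n))) = 1 := by
      rw [show -(k / n * (2 * Real.pi * n) : ℝ) = 2 * Real.pi * ((-k : ℤ) : ℝ) by
        push_cast; field_simp]
      exact circleCurve_two_pi_mul _
    rw [gammaCurve, gammaCurve, relDir_add, relDir, angularSpeed_discParam hkn, circleCurve_add,
      e1, e2, mul_one, mul_one]
  correspondence := by
    rw [two_mul_bicycleLength hk hkn]
    exact inBicycleCorrespondence_gammaCurve (discParam_pos hkn) (discParam_lt_one hk hkn)
  initial := by
    rw [two_mul_bicycleLength hk hkn, gammaCurve, relDir_zero (discParam_lt_one hk hkn),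
      circleCurve_zero]
    push_cast
    ring

lemma IsGammaCurve.eq_gammaCurve {k n : ℕ} (hk : 1 ≤ k) (hkn : k < n) {Γ : ℝ → ℂ}
    (h : IsGammaCurve k n Γ) : Γ = gammaCurve (discParam k n) :=
  _root_.eq_gammaCurve (discParam_pos hkn) (discParam_lt_one hk hkn)
    (two_mul_bicycleLength hk hkn ▸ h.correspondence)
    (h.initial.trans (isGammaCurve_gammaCurve hk hkn).initial.symm)

lemma isRotationNumber_gammaCurve_iff {k n : ℕ} (hk : 1 ≤ k) (hkn : k < n)
    (hcop : Nat.Coprime k n) (ρ : ℝ) :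
    IsRotationNumber (2 * Real.pi * n) (gammaCurve (discParam k n)) ρ ↔
      ρ ∈ Set.Ioo (0 : ℝ) 1 ∧ SolvesTanEquation k n ρ := by
  refine and_congr_right fun hρ => ?_
  have hn : (0 : ℝ) < n := by exact_mod_cast (by omega : 0 < n)
  have hnk : (0 : ℝ) < n + k := by positivity
  rw [exists_inBicycleCorrespondence_shift_iff (discParam_pos hkn) (discParam_lt_one hk hkn),
    angularSpeed_discParam hkn, discParam_sq hkn,
    show (ρ * (2 * Real.pi * n) - k / n * (ρ * (2 * Real.pi * n))) / 2 =
      (n - k) * (Real.pi * ρ) by field_simp,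
    show (ρ * (2 * Real.pi * n) + k / n * (ρ * (2 * Real.pi * n))) / 2 =
      (n + k) * (Real.pi * ρ) by field_simp, div_mul_eq_mul_div, eq_div_iff hnk.ne',
    mul_comm _ ((n : ℝ) + k), ← solvesTanEquation_iff_sin hk hkn hcop hρ]
  -- Positivity of the chord is automatic for a solution in `(0, 1)`.
  refine and_iff_right_of_imp fun hsol hone => ?_
  have hsin := sin_mul_pi_mul_ne_zero_of_solvesTanEquation hk hkn hcop hρ hsol
  have h := circleCurve_two_mul_sub_one (n * Real.pi * ρ)
  rw [show 2 * (n * Real.pi * ρ) = ρ * (2 * Real.pi * n) by ring, hone, sub_self] at h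
  have hsinc : (Real.sin (n * Real.pi * ρ) : ℂ) ≠ 0 := by exact_mod_cast hsin
  exact mul_ne_zero (circleCurve_ne_zero _)
    (mul_ne_zero (mul_ne_zero two_ne_zero I_ne_zero) hsinc) h.symm

theorem theorem4p7 (k n : ℕ) (hk : 1 ≤ k) (hkn : k < n) (hcop : Nat.Coprime k n) :
    (∃! Γ : ℝ → ℂ, IsGammaCurve k n Γ) ∧
    ∀ Γ : ℝ → ℂ, IsGammaCurve k n Γ →
      IsClosedArcLengthCurve (2 * Real.pi * n) Γ ∧
      (IsZindlerCurve (2 * Real.pi * n) Γ ↔ 1 ≤ k ∧ k + 2 ≤ n) ∧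
      {ρ : ℝ | IsRotationNumber (2 * Real.pi * n) Γ ρ}.encard = ((n - k - 1 : ℕ) : ℕ∞) ∧
      {ρ : ℝ | IsRotationNumber (2 * Real.pi * n) Γ ρ} =
        {ρ : ℝ | ρ ∈ Set.Ioo (0 : ℝ) 1 ∧ SolvesTanEquation k n ρ} := by
  refine ⟨⟨_, isGammaCurve_gammaCurve hk hkn, fun Γ h => h.eq_gammaCurve hk hkn⟩, fun Γ h => ?_⟩
  have hn : (0 : ℝ) < n := by exact_mod_cast (by omega : 0 < n)
  have hq := discParam_pos hkn
  have hq1 := discParam_lt_one hk hkn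
  have hset : {ρ : ℝ | IsRotationNumber (2 * Real.pi * n) Γ ρ} =
      {ρ : ℝ | ρ ∈ Set.Ioo (0 : ℝ) 1 ∧ SolvesTanEquation k n ρ} := by
    rw [h.eq_gammaCurve hk hkn]
    exact Set.ext (isRotationNumber_gammaCurve_iff hk hkn hcop)
  have hcard : {ρ : ℝ | IsRotationNumber (2 * Real.pi * n) Γ ρ}.encard =
      ((n - k - 1 : ℕ) : ℕ∞) := by
    rw [hset, encard_solvesTanEquation hk hkn hcop]
  have harc : IsClosedArcLengthCurve (2 * Real.pi * n) Γ := by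
    refine ⟨mul_pos Real.two_pi_pos hn, h.correspondence.smooth_right, fun t => ?_, h.closed⟩
    rw [h.eq_gammaCurve hk hkn]
    exact norm_deriv_gammaCurve hq hq1 t
  refine ⟨harc, ?_, hcard, hset⟩
  -- Truncated subtraction is harmless: since `k < n`, the count is exact and vanishes only for `k =
  -- n - 1`.
  have hne : (∃ ρ, IsRotationNumber (2 * Real.pi * n) Γ ρ) ↔ n - k - 1 ≠ 0 := by
    have := Set.encard_ne_zero (s := {ρ : ℝ | IsRotationNumber (2 * Real.pi * n) Γ ρ})
    rw [hcard] at this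
    exact this.symm.trans (by exact_mod_cast Iff.rfl)
  rw [IsZindlerCurve, and_iff_right harc, hne]
  omega
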